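/- Let $\Bbbk$ be an algebraically closed field of characteristic zero, let $\mathfrak g=\mathfrak{sl}_2(\Bbbk)$ with standard basis $\mathrm e,\mathrm h,\mathrm f$, let $\mathcal A=\Bbbk[t,t^{-1}]$, and let $\hat{\mathfrak g}=\mathfrak g\otimes\mathcal A$ be the loop algebra, with bracket $[x\otimes a,y\otimes b]=[x,y]\otimes ab$. Let $\mathcal A$ act on the space of all functions $\varphi:\mathbb Z\to\Bbbk$ by $(t^n\cdot\varphi)(m)=\varphi(m+n)$. A function $\varphi:\mathbb Z\to\Bbbk$ is exponential polynomial if it is a finite sum $\varphi(m)=\sum_{\lambda\in\Bbbk^\times}\varphi_\lambda(m)\lambda^m$ with polynomial functions $\varphi_\lambda$; its characteristic polynomial $c_\varphi\in\Bbbk[t]$ is the monic generator of the (non-zero) ideal $\{c\in\Bbbk[t] : c\cdot\varphi=0\}$. For such $\varphi$, let $\Bbbk v_\varphi$ be the one-dimensional module over the subalgebra $(\Bbbk\mathrm h\oplus\Bbbk\mathrm e)\otimes\mathcal A$ of $\hat{\mathfrak g}$ on which $\mathrm h\otimes a$ acts by the scalar $(a\cdot\varphi)(0)$ and $\mathrm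 e\otimes a$ acts by $0$, for all $a\in\mathcal A$, and let $L(\varphi)$ be the unique irreducible quotient of the $\hat{\mathfrak g}$-module induced from $\Bbbk v_\varphi$. Proposition. Let $\varphi_1,\varphi_2:\mathbb Z\to\Bbbk$ be exponential-polynomial functions whose characteristic polynomials $c_{\varphi_1}$ and $c_{\varphi_2}$ are coprime. Then $$L(\varphi_1+\varphi_2)\;\cong\;L(\varphi_1)\otimes_{\Bbbk}L(\varphi_2)$$ as $\hat{\mathfrak g}$-modules. -/

import Mathlib

open scoped TensorProduct LaurentPolynomial

noncomputable section

namespace ExpPolyLoop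

/-! ### Exponential-polynomial functions and their characteristic polynomials -/

section Functions

variable {k : Type*} [Field k]

/-- `φ : ℤ → k` is exponential polynomial: a finite sum `∑_μ p_μ(m) μ^m` over distinct
nonzero scalars `μ`, with polynomial coefficient functions `p_μ`. -/
def IsExpPoly (φ : ℤ → k) : Prop :=
  ∃ p : kˣ →₀ Polynomial k,
    ∀ m : ℤ, φ m = p.sum fun μ q => q.eval (m : k) * ((μ ^ m : kˣ) : k)

variable (k) in
/-- The action of the Laurent polynomials on all functions `ℤ → k`, in which `T n` acts by
the shift `(T n · φ) m = φ (m + n)`. -/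
def laurentAction : k[T;T⁻¹] →ₐ[k] Module.End k (ℤ → k) :=
  AddMonoidAlgebra.lift k (Module.End k (ℤ → k)) ℤ
    { toFun := fun n => LinearMap.funLeft k k (fun m : ℤ => m + n.toAdd)
      map_one' := by ext; simp [LinearMap.funLeft_apply]
      map_mul' := fun a b => by
        ext φ m
        simp [LinearMap.funLeft_apply, add_assoc] }

theorem laurentAction_T (n : ℤ) (φ : ℤ → k) (m : ℤ) :
    laurentAction k (LaurentPolynomial.T n) φ m = φ (m + n) := by
  unfold laurentAction LaurentPolynomial.T
  rw [AddMonoidAlgebra.lift_single, one_smul]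
  rfl

/-- The annihilator of `φ` in the polynomial ring `k[t]`. -/
def annihilator (φ : ℤ → k) : Ideal (Polynomial k) where
  carrier := {c | laurentAction k (Polynomial.toLaurent c) φ = 0}
  add_mem' := fun {a b} ha hb => by
    simp only [Set.mem_ofPred_eq, map_add, LinearMap.add_apply] at *
    rw [ha, hb, add_zero]
  zero_mem' := by simp
  smul_mem' := fun c x hx => by
    simp only [Set.mem_ofPred_eq, smul_eq_mul, map_mul, Module.End.mul_apply] at *
    rw [hx, map_zero]

/-- The characteristic polynomial of `φ`: the monic generator of its annihilator (a generator
divided by its leading coefficient). -/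
def charPoly (φ : ℤ → k) : Polynomial k :=
  Polynomial.C (Submodule.IsPrincipal.generator (annihilator φ)).leadingCoeff⁻¹ *
    Submodule.IsPrincipal.generator (annihilator φ)

end Functions

/-! ### Modules induced from characters, and their irreducible quotients -/

section Induced

variable {k L : Type*} [Field k] [LieRing L] [LieAlgebra k L]

/-- The `L`-module `Ind_B^L k_χ = U(L) ⊗_{U(B)} k_χ` induced from the one-dimensional
`B`-module with character `χ`, realised as the quotient of `U(L)` by the left ideal generated
by the elements `x - χ(x)`, `x ∈ B`. -/
def Induced (B : LieSubalgebra k L) (χ : LieAlgebra.LieCharacter k B) : Type _ :=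
  UniversalEnvelopingAlgebra k L ⧸
    Submodule.span (UniversalEnvelopingAlgebra k L) (Set.range fun x : B =>
      UniversalEnvelopingAlgebra.ι k (x : L) -
        algebraMap k (UniversalEnvelopingAlgebra k L) (χ x))

variable (B : LieSubalgebra k L) (χ : LieAlgebra.LieCharacter k B)

instance : AddCommGroup (Induced B χ) :=
  inferInstanceAs (AddCommGroup (UniversalEnvelopingAlgebra k L ⧸ Submodule.span _ _))

instance : Module (UniversalEnvelopingAlgebra k L) (Induced B χ) :=
  inferInstanceAs (Module _ (UniversalEnvelopingAlgebra k L ⧸ Submodule.span _ _))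

instance : Module k (Induced B χ) :=
  inferInstanceAs (Module k (UniversalEnvelopingAlgebra k L ⧸ Submodule.span _ _))

instance : IsScalarTower k (UniversalEnvelopingAlgebra k L) (Induced B χ) :=
  inferInstanceAs (IsScalarTower k (UniversalEnvelopingAlgebra k L)
    (UniversalEnvelopingAlgebra k L ⧸ Submodule.span _ _))

/-- `L` acts on the induced module through `L → U(L)`. -/
instance : LieRingModule L (Induced B χ) where
  bracket x v := UniversalEnvelopingAlgebra.ι k x • v
  add_lie x y v := by
    change UniversalEnvelopingAlgebra.ι k (x + y) • v = _
    rw [map_add, add_smul]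
  lie_add x v w := smul_add _ v w
  leibniz_lie x y v := by
    change UniversalEnvelopingAlgebra.ι k x • UniversalEnvelopingAlgebra.ι k y • v =
      UniversalEnvelopingAlgebra.ι k ⁅x, y⁆ • v +
      UniversalEnvelopingAlgebra.ι k y • UniversalEnvelopingAlgebra.ι k x • v
    let : LieRing (UniversalEnvelopingAlgebra k L) := LieRing.ofAssociativeRing
    rw [LieHom.map_lie, LieRing.of_associative_ring_bracket, sub_smul, mul_smul, mul_smul]
    abel

instance : LieModule k L (Induced B χ) where
  smul_lie c x v := by
    change UniversalEnvelopingAlgebra.ι k (c • x) • v =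
      c • UniversalEnvelopingAlgebra.ι k x • v
    rw [map_smul, smul_assoc]
  lie_smul c x v := by
    change UniversalEnvelopingAlgebra.ι k x • c • v =
      c • UniversalEnvelopingAlgebra.ι k x • v
    rw [← algebraMap_smul (UniversalEnvelopingAlgebra k L) c v,
      ← algebraMap_smul (UniversalEnvelopingAlgebra k L) c
        (UniversalEnvelopingAlgebra.ι k x • v), ← mul_smul, ← mul_smul, Algebra.commutes]

/-- The sum of all proper submodules of a module. For a highest-weight module this is its
unique maximal proper submodule. -/
def sumProper (k L M : Type*) [CommRing k] [LieRing L] [AddCommGroup M] [Module k M]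
    [LieRingModule L M] : LieSubmodule k L M :=
  sSup {N | N ≠ ⊤}

end Induced

/-! ### The loop algebra of `sl₂` and its highest-weight modules -/

section Loop

variable (k : Type*) [Field k]

/-- The Lie algebra `𝔤 = sl₂` of traceless `2 × 2` matrices. -/
abbrev SL2 : Type _ := LieAlgebra.SpecialLinear.sl (Fin 2) k

/-- The standard basis vector `e`. -/
def e : SL2 k := ⟨!![0, 1; 0, 0], by
  simp [LieAlgebra.SpecialLinear.sl, Matrix.trace_fin_two]⟩

/-- The standard basis vector `h`. -/
def h : SL2 k := ⟨!![1, 0; 0, -1], by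
  simp [LieAlgebra.SpecialLinear.sl, Matrix.trace_fin_two]⟩

theorem lie_h_e : ⁅h k, e k⁆ = (2 : k) • e k := by
  apply Subtype.ext
  rw [LieAlgebra.SpecialLinear.sl_bracket]
  ext i j
  fin_cases i <;> fin_cases j <;>
    norm_num [h, e, Matrix.mul_apply]

/-- The loop algebra `𝔤̂ = k[t, t⁻¹] ⊗ 𝔤`. -/
def LoopSL2 : Type _ := LieAlgebra.loopAlgebra k ℤ (SL2 k)

instance : LieRing (LoopSL2 k) := inferInstanceAs (LieRing (LieAlgebra.loopAlgebra k ℤ (SL2 k)))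

instance : LieAlgebra k (LoopSL2 k) :=
  inferInstanceAs (LieAlgebra k (LieAlgebra.loopAlgebra k ℤ (SL2 k)))

variable {k} in
/-- The map `a ↦ x ⊗ a` from the Laurent polynomials to the loop algebra (Mathlib writes the
factors of the loop algebra in the opposite order). -/
def loopElt (x : SL2 k) : k[T;T⁻¹] →ₗ[k] LoopSL2 k :=
  (TensorProduct.mk k k[T;T⁻¹] (SL2 k)).flip x

theorem lie_loopElt (x y : SL2 k) (a b : k[T;T⁻¹]) :
    ⁅loopElt x a, loopElt y b⁆ = loopElt ⁅x, y⁆ (a * b) :=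
  LieAlgebra.ExtendScalars.bracket_tmul k k[T;T⁻¹] (SL2 k) (SL2 k) a b x y

theorem lie_borel (a b c d : k[T;T⁻¹]) :
    ⁅loopElt (h k) a + loopElt (e k) b, loopElt (h k) c + loopElt (e k) d⁆ =
      loopElt (e k) ((2 : k) • (a * d - c * b)) := by
  have hs : ∀ p : k[T;T⁻¹], loopElt ((2 : k) • e k) p = (2 : k) • loopElt (e k) p :=
    fun p => TensorProduct.tmul_smul _ _ _
  have h1 : ⁅loopElt (h k) a, loopElt (h k) c⁆ = 0 := by
    rw [lie_loopElt, lie_self]; exact TensorProduct.tmul_zero _ _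
  have h2 : ⁅loopElt (e k) b, loopElt (e k) d⁆ = 0 := by
    rw [lie_loopElt, lie_self]; exact TensorProduct.tmul_zero _ _
  have h3 : ⁅loopElt (h k) a, loopElt (e k) d⁆ = (2 : k) • loopElt (e k) (a * d) := by
    rw [lie_loopElt, lie_h_e, hs]
  have h4 : ⁅loopElt (e k) b, loopElt (h k) c⁆ = -((2 : k) • loopElt (e k) (c * b)) := by
    rw [← lie_skew, lie_loopElt, lie_h_e, hs]
  rw [add_lie, lie_add, lie_add, h1, h2, h3, h4, map_smul, map_sub, smul_sub]
  abel

/-- The subalgebra `𝔥̂ + 𝔤̂₊` of the loop algebra, where `𝔥 = k h` and `𝔤₊ = k e`. -/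
def borel : LieSubalgebra k (LoopSL2 k) where
  toSubmodule := LinearMap.range (loopElt (h k)) ⊔ LinearMap.range (loopElt (e k))
  lie_mem' := fun {x y} hx hy => by
    obtain ⟨_, ⟨a, rfl⟩, _, ⟨b, rfl⟩, rfl⟩ := Submodule.mem_sup.1 hx
    obtain ⟨_, ⟨c, rfl⟩, _, ⟨d, rfl⟩, rfl⟩ := Submodule.mem_sup.1 hy
    refine Submodule.mem_sup_right ?_
    rw [lie_borel]
    exact ⟨_, rfl⟩

variable {k}

/-- The linear functional on the loop algebra with `a ⊗ h ↦ (a · φ)(0)`, `a ⊗ e ↦ 0`,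
`a ⊗ f ↦ 0`; the entry `x 0 0` is the coefficient of `h` in `x ∈ sl₂`. -/
def weightFunctional (φ : ℤ → k) : LoopSL2 k →ₗ[k] k :=
  TensorProduct.lift (LinearMap.mk₂ k
    (fun (a : k[T;T⁻¹]) (x : SL2 k) => laurentAction k a φ 0 * (x : Matrix (Fin 2) (Fin 2) k) 0 0)
    (fun a b x => by simp [add_mul])
    (fun c a x => by simp [mul_assoc])
    (fun a x y => by simp [mul_add])
    (fun c a x => by simp [mul_left_comm]))

theorem weightFunctional_loopElt (φ : ℤ → k) (x : SL2 k) (a : k[T;T⁻¹]) :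
    weightFunctional φ (loopElt x a) =
      laurentAction k a φ 0 * (x : Matrix (Fin 2) (Fin 2) k) 0 0 :=
  TensorProduct.lift.tmul a x

theorem weightFunctional_h (φ : ℤ → k) (a : k[T;T⁻¹]) :
    weightFunctional φ (loopElt (h k) a) = laurentAction k a φ 0 := by
  rw [weightFunctional_loopElt]; simp [h]

theorem weightFunctional_e (φ : ℤ → k) (a : k[T;T⁻¹]) :
    weightFunctional φ (loopElt (e k) a) = 0 := by
  rw [weightFunctional_loopElt]; simp [e]

/-- The one-dimensional `(𝔥̂ + 𝔤̂₊)`-module attached to `φ`, as a character: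
`h ⊗ a` acts by `(a · φ)(0)` and `e ⊗ a` acts by `0`. -/
def weightCharacter (φ : ℤ → k) : LieAlgebra.LieCharacter k (borel k) :=
  letI : LieRing k := LieRing.ofAssociativeRing
  { toLinearMap := weightFunctional φ ∘ₗ (borel k).toSubmodule.subtype
    map_lie' := fun {x y} => by
      obtain ⟨x, hx⟩ := x
      obtain ⟨y, hy⟩ := y
      obtain ⟨_, ⟨a, rfl⟩, _, ⟨b, rfl⟩, rfl⟩ := Submodule.mem_sup.1 hx
      obtain ⟨_, ⟨c, rfl⟩, _, ⟨d, rfl⟩, rfl⟩ := Submodule.mem_sup.1 hy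
      change weightFunctional φ ⁅loopElt (h k) a + loopElt (e k) b,
        loopElt (h k) c + loopElt (e k) d⁆ = _
      rw [lie_borel, weightFunctional_e, LieRing.of_associative_ring_bracket, mul_comm,
        sub_self] }

/-- The induced `𝔤̂`-module of highest weight `φ`. -/
abbrev Verma (φ : ℤ → k) : Type _ := Induced (borel k) (weightCharacter φ)

/-- The irreducible highest-weight `𝔤̂`-module `L(φ)`: the irreducible quotient of the induced
module, by its largest proper submodule. -/
abbrev Irred (φ : ℤ → k) : Type _ := Verma φ ⧸ sumProper k (LoopSL2 k) (Verma φ)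

end Loop

end ExpPolyLoop

end

/-!
Let `v` be the highest-weight vector of `L(φ)`. Every other weight of `h ⊗ 1` on `L(φ)` is
`φ 0 - 2n` with `n > 0`, so a submodule generated by lower weight vectors that the Borel subalgebra
preserves is proper, hence zero. This shows that `x ⊗ c` acts by zero on `L(φ)` whenever
`c · φ = 0`, and that the only endomorphisms of `L(φ)` are scalars.

If `u₁ c₁ + u₂ c₂ = 1` with `cᵢ · φᵢ = 0`, then `x ⊗ u₂ c₂ b` acts as `x ⊗ b` on `L(φ₁)` and by
zero on `L(φ₂)`: the loop algebra acts independently on the two factors. By the density theorem a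
submodule of the tensor product is then stable under all `T ⊗ 1`, and `L(φ₁) ⊗ L(φ₂)` is
irreducible. As `v₁ ⊗ v₂` is a highest-weight vector for `φ₁ + φ₂`, the universal property of the
induced module identifies the product with `L(φ₁ + φ₂)`.

That the induced module is non-zero is seen without the Poincaré–Birkhoff–Witt theorem, by
exhibiting a highest-weight vector in the Fock space `Sym k[t, t⁻¹]`.
-/

noncomputable section

namespace ExpPolyLoop

/-! ### Tensor products of independent actions -/

section TensorProduct

variable {k M₁ M₂ : Type*} [AddCommGroup M₁] [AddCommGroup M₂]

section CommRing

variable [CommRing k] [Module k M₁] [Module k M₂]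

theorem exists_finset_rTensor_eq (z : M₁ ⊗[k] M₂) :
    ∃ s : Finset M₁, ∀ S T : Module.End k M₁, (∀ m ∈ s, S m = T m) →
      S.rTensor M₂ z = T.rTensor M₂ z := by
  classical
  obtain ⟨t, rfl⟩ := TensorProduct.exists_finset z
  refine ⟨t.image Prod.fst, fun S T hST => ?_⟩
  simp only [map_sum, LinearMap.rTensor_tmul]
  exact Finset.sum_congr rfl fun p hp => by rw [hST _ (Finset.mem_image_of_mem _ hp)]

theorem rTensor_smulRight (ξ : M₁ →ₗ[k] k) (m : M₁) (z : M₁ ⊗[k] M₂) :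
    (ξ.smulRight m).rTensor M₂ z = m ⊗ₜ TensorProduct.lid k M₂ (ξ.rTensor M₂ z) := by
  induction z with
  | zero => simp
  | tmul m₁ m₂ => simp [TensorProduct.smul_tmul]
  | add y z hy hz => simp only [map_add, hy, hz, TensorProduct.tmul_add]

end CommRing

section Field

variable [Field k] [Module k M₁] [Module k M₂]

theorem tmul_ne_zero {m₁ : M₁} {m₂ : M₂} (h₁ : m₁ ≠ 0) (h₂ : m₂ ≠ 0) : m₁ ⊗ₜ[k] m₂ ≠ 0 :=
  have hlin₁ : LinearIndependent k fun _ : Unit => m₁ := .of_subsingleton () h₁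
  have hlin₂ : LinearIndependent k fun _ : Unit => m₂ := .of_subsingleton () h₂
  (hlin₁.tmul_of_isDomain hlin₂).ne_zero ((), ())

theorem exists_rTensor_ne_zero {z : M₁ ⊗[k] M₂} (hz : z ≠ 0) :
    ∃ ξ : M₁ →ₗ[k] k, ξ.rTensor M₂ z ≠ 0 := by
  classical
  let b := Module.Basis.ofVectorSpace k M₁
  obtain ⟨i, hi⟩ := Finsupp.ne_iff.1
    ((TensorProduct.equivFinsuppOfBasisLeft (N := M₂) b).map_ne_zero_iff.2 hz)
  rw [TensorProduct.equivFinsuppOfBasisLeft_apply] at hi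
  exact ⟨b.coord i, fun h0 => hi (by rw [h0, map_zero, Finsupp.zero_apply])⟩

end Field

end TensorProduct

section IndependentActions

variable {k L M₁ M₂ : Type*} [CommRing k] [LieRing L] [LieAlgebra k L]
  [AddCommGroup M₁] [Module k M₁] [LieRingModule L M₁] [LieModule k L M₁]
  [AddCommGroup M₂] [Module k M₂] [LieRingModule L M₂] [LieModule k L M₂]

variable (L M₁ M₂) in
/-- `L` acts independently on `M₁` and `M₂` if every element of `L` can be replaced by one that
acts in the same way on `M₁` and by zero on `M₂`. Subtracting the two elements shows that this
condition is symmetric in `M₁` and `M₂`. -/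
def ActIndependently : Prop :=
  ∀ x : L, ∃ y : L, (∀ m : M₁, ⁅y, m⁆ = ⁅x, m⁆) ∧ ∀ m : M₂, ⁅y, m⁆ = 0

theorem exists_mem_adjoin_toEnd_eqOn [LieModule.IsIrreducible k L M₁]
    (hscalar : ∀ g : M₁ →ₗ⁅k,L⁆ M₁, ∃ c : k, ∀ m, g m = c • m)
    (T : Module.End k M₁) (s : Finset M₁) :
    ∃ a ∈ Algebra.adjoin k (Set.range (LieModule.toEnd k L M₁)), ∀ m ∈ s, T m = a m := by
  let R := Algebra.adjoin k (Set.range (LieModule.toEnd k L M₁))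
  let act (x : L) : R := ⟨LieModule.toEnd k L M₁ x, Algebra.subset_adjoin ⟨x, rfl⟩⟩
  let toLieSubmodule (N : Submodule R M₁) : LieSubmodule k L M₁ :=
    { N.restrictScalars k with lie_mem := fun {x _} hm => N.smul_mem (act x) hm }
  have : Nontrivial M₁ := (LieSubmodule.nontrivial_iff k L M₁).1 inferInstance
  have : IsSimpleModule R M₁ :=
    { eq_bot_or_eq_top N := by
        rcases eq_bot_or_eq_top (toLieSubmodule N) with hN | hN
        · exact .inl (SetLike.coe_injective (SetLike.ext'_iff.1 hN :))
        · exact .inr (SetLike.coe_injective (SetLike.ext'_iff.1 hN :)) }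
  have hend (g : Module.End R M₁) : ∃ c : k, ∀ m, g m = c • m :=
    hscalar { g.restrictScalars k with map_lie' := fun {x m} => g.map_smul (act x) m }
  have hT (g : Module.End R M₁) (m : M₁) : T (g m) = g (T m) := by
    obtain ⟨c, hc⟩ := hend g
    rw [hc, hc, map_smul]
  obtain ⟨a, ha⟩ := jacobson_density (R := R) { T with map_smul' := hT } s
  exact ⟨a, a.2, ha⟩

namespace ActIndependently

theorem rTensor_toEnd_mem (hind : ActIndependently L M₁ M₂) {N : LieSubmodule k L (M₁ ⊗[k] M₂)}
    {z : M₁ ⊗[k] M₂} (hz : z ∈ N) (x : L) :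
    (LieModule.toEnd k L M₁ x).rTensor M₂ z ∈ N := by
  obtain ⟨y, hy₁, hy₂⟩ := hind x
  have hx : (LieModule.toEnd k L M₁ x).rTensor M₂ =
      LieModule.toEnd k L (M₁ ⊗[k] M₂) y := by
    ext m n
    simp [hy₁, hy₂]
  rw [hx]
  exact N.lie_mem hz

theorem rTensor_mem (hind : ActIndependently L M₁ M₂) {N : LieSubmodule k L (M₁ ⊗[k] M₂)}
    [LieModule.IsIrreducible k L M₁]
    (hscalar : ∀ g : M₁ →ₗ⁅k,L⁆ M₁, ∃ c : k, ∀ m, g m = c • m)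
    {z : M₁ ⊗[k] M₂} (hz : z ∈ N) (T : Module.End k M₁) : T.rTensor M₂ z ∈ N := by
  obtain ⟨s, hs⟩ := exists_finset_rTensor_eq z
  obtain ⟨a, ha, haT⟩ := exists_mem_adjoin_toEnd_eqOn hscalar T s
  rw [hs T a haT]
  clear hs haT
  induction ha using Algebra.adjoin_induction generalizing z with
  | mem _ hx =>
    obtain ⟨x, rfl⟩ := hx
    exact hind.rTensor_toEnd_mem hz x
  | algebraMap r =>
    rw [Algebra.algebraMap_eq_smul_one, LinearMap.rTensor_smul, Module.End.one_eq_id,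
      LinearMap.rTensor_id]
    exact N.smul_mem r hz
  | add a b _ _ ha hb =>
    rw [LinearMap.rTensor_add]
    exact add_mem (ha hz) (hb hz)
  | mul a b _ _ ha hb =>
    rw [Module.End.mul_eq_comp, LinearMap.rTensor_comp]
    exact ha (hb hz)

/-- The vectors `n` with `m ⊗ n ∈ N`. -/
def rightSlice (hind : ActIndependently L M₁ M₂) (N : LieSubmodule k L (M₁ ⊗[k] M₂)) (m : M₁) :
    LieSubmodule k L M₂ :=
  { N.toSubmodule.comap (TensorProduct.mk k M₁ M₂ m) with
    lie_mem := fun {x n} hn => by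
      have hx : TensorProduct.mk k M₁ M₂ m ⁅x, n⁆ = ⁅x, m ⊗ₜ[k] n⁆ -
          (LieModule.toEnd k L M₁ x).rTensor M₂ (m ⊗ₜ[k] n) := by simp
      rw [AddSubsemigroup.mem_carrier, AddSubmonoid.mem_toSubsemigroup,
        Submodule.mem_toAddSubmonoid, Submodule.mem_comap, hx]
      exact sub_mem (N.lie_mem hn) (hind.rTensor_toEnd_mem hn x) }

theorem mem_rightSlice (hind : ActIndependently L M₁ M₂) {N : LieSubmodule k L (M₁ ⊗[k] M₂)}
    {m : M₁} {n : M₂} : n ∈ hind.rightSlice N m ↔ m ⊗ₜ[k] n ∈ N :=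
  Iff.rfl

end ActIndependently

end IndependentActions

theorem ActIndependently.isIrreducible_tensorProduct {k L M₁ M₂ : Type*} [Field k] [LieRing L]
    [LieAlgebra k L] [AddCommGroup M₁] [Module k M₁] [LieRingModule L M₁] [LieModule k L M₁]
    [AddCommGroup M₂] [Module k M₂] [LieRingModule L M₂] [LieModule k L M₂]
    (hind : ActIndependently L M₁ M₂)
    [LieModule.IsIrreducible k L M₁] [LieModule.IsIrreducible k L M₂]
    (hscalar : ∀ g : M₁ →ₗ⁅k,L⁆ M₁, ∃ c : k, ∀ m, g m = c • m) :
    LieModule.IsIrreducible k L (M₁ ⊗[k] M₂) := by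
  have : Nontrivial M₁ := (LieSubmodule.nontrivial_iff k L M₁).1 inferInstance
  have : Nontrivial M₂ := (LieSubmodule.nontrivial_iff k L M₂).1 inferInstance
  refine .mk fun N hN => ?_
  obtain ⟨z, hzN, hz⟩ : ∃ z ∈ N, z ≠ 0 := by simpa [LieSubmodule.eq_bot_iff] using hN
  obtain ⟨ξ, hξ⟩ := exists_rTensor_ne_zero hz
  have hslice (m : M₁) : hind.rightSlice N m = ⊤ := by
    have hmem : TensorProduct.lid k M₂ (ξ.rTensor M₂ z) ∈ hind.rightSlice N m :=
      hind.mem_rightSlice.2 (rTensor_smulRight ξ m z ▸ hind.rTensor_mem hscalar hzN _)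
    refine (eq_bot_or_eq_top _).resolve_left fun hbot => hξ ?_
    rwa [hbot, LieSubmodule.mem_bot, LinearEquiv.map_eq_zero_iff] at hmem
  rw [eq_top_iff]
  rintro w -
  induction w with
  | zero => exact N.zero_mem
  | tmul m n => exact hind.mem_rightSlice.1 (hslice m ▸ LieSubmodule.mem_top n)
  | add y z hy hz => exact add_mem hy hz

section SumProper

variable {k L M M' : Type*} [CommRing k] [LieRing L] [LieAlgebra k L]
  [AddCommGroup M] [Module k M] [LieRingModule L M] [LieModule k L M]
  [AddCommGroup M'] [Module k M'] [LieRingModule L M']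

theorem isIrreducible_quotient_sumProper (hM : sumProper k L M ≠ ⊤) :
    LieModule.IsIrreducible k L (M ⧸ sumProper k L M) := by
  have hnt : Nontrivial (M ⧸ sumProper k L M) :=
    Submodule.Quotient.nontrivial_iff.2 fun htop => hM ((LieSubmodule.toSubmodule_eq_top _).1 htop)
  refine .mk fun N hN => ?_
  let π := LieSubmodule.Quotient.mk' (sumProper k L M)
  have hcomap : N.comap π = ⊤ := by
    by_contra htop
    have hle : N.comap π ≤ sumProper k L M := le_sSup htop
    refine hN ((LieSubmodule.eq_bot_iff N).2 fun m hm => ?_)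
    obtain ⟨m, rfl⟩ := LieSubmodule.Quotient.surjective_mk' _ m
    exact (LieSubmodule.Quotient.mk_eq_zero _).2 (hle (LieSubmodule.mem_comap.2 hm))
  rw [eq_top_iff]
  rintro m -
  obtain ⟨m, rfl⟩ := LieSubmodule.Quotient.surjective_mk' _ m
  exact LieSubmodule.mem_comap.1 (hcomap ▸ LieSubmodule.mem_top m)

theorem nonempty_quotient_ker_equiv {F : M →ₗ⁅k,L⁆ M'} (hF : Function.Surjective F) :
    Nonempty ((M ⧸ F.ker) ≃ₗ⁅k,L⁆ M') :=
  let E : (M ⧸ F.ker) ≃ₗ[k] M' := (F : M →ₗ[k] M').quotKerEquivOfSurjective hF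
  ⟨{ E with
      map_lie' := fun {x m} => by
        obtain ⟨m, rfl⟩ := LieSubmodule.Quotient.surjective_mk' _ m
        exact F.map_lie x m }⟩

omit [LieAlgebra k L] [LieModule k L M] in
theorem ker_eq_sumProper [LieModule.IsIrreducible k L M'] (hM : sumProper k L M ≠ ⊤)
    {F : M →ₗ⁅k,L⁆ M'} (hF : F ≠ 0) : F.ker = sumProper k L M := by
  have hker : F.ker ≤ sumProper k L M :=
    le_sSup fun htop => hF (LieModuleHom.ext fun m =>
      LieModuleHom.mem_ker.1 (htop ▸ LieSubmodule.mem_top m))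
  refine le_antisymm hker ((LieModuleHom.le_ker_iff_map _).2 ?_)
  refine (eq_bot_or_eq_top _).resolve_right fun htop => hM (eq_top_iff.2 fun m _ => ?_)
  obtain ⟨n, hn, hnm⟩ := (LieSubmodule.mem_map _).1 (htop ▸ LieSubmodule.mem_top (F m))
  have hsub : m - n ∈ F.ker := LieModuleHom.mem_ker.2 (by rw [map_sub, hnm, sub_self])
  simpa using add_mem (hker hsub) hn

theorem nonempty_quotient_sumProper_equiv [LieModule.IsIrreducible k L M']
    (hM : sumProper k L M ≠ ⊤) {F : M →ₗ⁅k,L⁆ M'} (hF : F ≠ 0) :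
    Nonempty ((M ⧸ sumProper k L M) ≃ₗ⁅k,L⁆ M') := by
  rw [← ker_eq_sumProper hM hF]
  refine nonempty_quotient_ker_equiv ((LieModuleHom.range_eq_top F).1 ?_)
  rw [← LieModuleHom.map_top]
  refine (eq_bot_or_eq_top _).resolve_left fun hbot => hF (LieModuleHom.ext fun m => ?_)
  exact LieModuleHom.mem_ker.1 ((LieModuleHom.le_ker_iff_map _).2 hbot (LieSubmodule.mem_top m))

end SumProper

section Triangular

variable {k L M : Type*} [CommRing k] [LieRing L] [LieAlgebra k L]
  [AddCommGroup M] [Module k M] [LieRingModule L M] [LieModule k L M]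

theorem lieSpan_le_of_sup_eq_top {B n : Submodule k L} (hBn : B ⊔ n = ⊤) {K S : Submodule k M}
    (hK : ∀ x ∈ B, ∀ m ∈ K, ⁅x, m⁆ ∈ K) (hKS : K ≤ S) (hS : ∀ y ∈ n, ∀ m ∈ S, ⁅y, m⁆ ∈ S) :
    (LieSubmodule.lieSpan k L (K : Set M)).toSubmodule ≤ S := by
  -- The smallest `n`-stable subspace containing `K` is already `L`-stable, by the Leibniz rule.
  let C : Submodule k M := sInf {S | K ≤ S ∧ ∀ y ∈ n, ∀ m ∈ S, ⁅y, m⁆ ∈ S}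
  have hKC : K ≤ C := le_sInf fun S hS => hS.1
  have hCS {S : Submodule k M} (hKS : K ≤ S) (hS : ∀ y ∈ n, ∀ m ∈ S, ⁅y, m⁆ ∈ S) : C ≤ S :=
    sInf_le ⟨hKS, hS⟩
  have hnC : ∀ y ∈ n, ∀ m ∈ C, ⁅y, m⁆ ∈ C := fun y hy m hm =>
    Submodule.mem_sInf.2 fun S hS => hS.2 y hy m (hCS hS.1 hS.2 hm)
  let T : Submodule k M := C ⊓ ⨅ x : L, C.comap (LieModule.toEnd k L M x)
  have mem_T {m : M} : m ∈ T ↔ m ∈ C ∧ ∀ x : L, ⁅x, m⁆ ∈ C := by simp [T]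
  have hCT : C ≤ T := by
    refine hCS (fun m hm => mem_T.2 ⟨hKC hm, fun x => ?_⟩) fun y hy m hm => mem_T.2 ?_
    · obtain ⟨b, hb, y, hy, rfl⟩ := Submodule.mem_sup.1 (hBn ▸ Submodule.mem_top : x ∈ B ⊔ n)
      rw [add_lie]
      exact add_mem (hKC (hK b hb m hm)) (hnC y hy m (hKC hm))
    · obtain ⟨hmC, hmL⟩ := mem_T.1 hm
      refine ⟨hnC y hy m hmC, fun x => ?_⟩
      rw [leibniz_lie]
      exact add_mem (hmL _) (hnC y hy _ (hmL x))
  let N : LieSubmodule k L M := { C with lie_mem := fun {x _} hm => (mem_T.1 (hCT hm)).2 x }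
  exact (LieSubmodule.toSubmodule_le_toSubmodule _ N).2 (LieSubmodule.lieSpan_le.2 hKC)
    |>.trans (hCS hKS hS)

end Triangular

section SL2Relations

variable (k : Type*) [Field k]

/-- The standard basis vector `f`. -/
def f : SL2 k := ⟨!![0, 0; 1, 0], by
  simp [LieAlgebra.SpecialLinear.sl, Matrix.trace_fin_two]⟩

theorem lie_e_f : ⁅e k, f k⁆ = h k := by
  apply Subtype.ext
  rw [LieAlgebra.SpecialLinear.sl_bracket]
  ext i j
  fin_cases i <;> fin_cases j <;> norm_num [h, e, f, Matrix.mul_apply]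

theorem lie_h_f : ⁅h k, f k⁆ = (-2 : k) • f k := by
  apply Subtype.ext
  rw [LieAlgebra.SpecialLinear.sl_bracket]
  ext i j
  fin_cases i <;> fin_cases j <;> norm_num [h, f, Matrix.mul_apply]

variable {k}

theorem sl2_apply_one_one (x : SL2 k) : x.1 1 1 = -x.1 0 0 :=
  eq_neg_of_add_eq_zero_right ((Matrix.trace_fin_two _).symm.trans x.2)

theorem sl2_eq (x : SL2 k) : x = x.1 0 0 • h k + x.1 0 1 • e k + x.1 1 0 • f k := by
  apply Subtype.ext
  ext i j
  fin_cases i <;> fin_cases j <;> simp [h, e, f, sl2_apply_one_one]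

theorem loopElt_smul (c : k) (x : SL2 k) (a : k[T;T⁻¹]) :
    loopElt (c • x) a = c • loopElt x a :=
  TensorProduct.tmul_smul c a x

theorem loopElt_add (x y : SL2 k) (a : k[T;T⁻¹]) :
    loopElt (x + y) a = loopElt x a + loopElt y a :=
  TensorProduct.tmul_add a x y

theorem loop_induction {p : LoopSL2 k → Prop} (z : LoopSL2 k)
    (elt : ∀ x a, p (loopElt x a)) (add : ∀ y z, p y → p z → p (y + z)) : p z := by
  induction z using TensorProduct.induction_on with
  | zero => exact map_zero (loopElt (0 : SL2 k)) ▸ elt 0 0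
  | tmul a x => exact elt x a
  | add y z hy hz => exact add y z hy hz

theorem borel_sup_range_loopElt_f :
    (borel k).toSubmodule ⊔ LinearMap.range (loopElt (f k)) = ⊤ := by
  rw [eq_top_iff]
  rintro z -
  induction z using loop_induction with
  | elt x a =>
    rw [sl2_eq x, loopElt_add, loopElt_add, loopElt_smul, loopElt_smul, loopElt_smul]
    exact Submodule.add_mem_sup
      (add_mem (Submodule.smul_mem _ _ (Submodule.mem_sup_left ⟨a, rfl⟩))
        (Submodule.smul_mem _ _ (Submodule.mem_sup_right ⟨a, rfl⟩)))
      (Submodule.smul_mem _ _ ⟨a, rfl⟩)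
  | add y z hy hz => exact add_mem hy hz

end SL2Relations

/-! ### Highest-weight vectors -/

section HighestWeight

variable {k : Type*} [Field k]
  {M : Type*} [AddCommGroup M] [Module k M] [LieRingModule (LoopSL2 k) M]
  {M' : Type*} [AddCommGroup M'] [Module k M'] [LieRingModule (LoopSL2 k) M']

/-- `v` is a non-zero vector which `e ⊗ a` annihilates and on which `h ⊗ a` acts by the scalar
`(a · φ)(0)`, for all `a`. Unlike in some texts, `v` need not generate the module. -/
structure IsHighestWeightVector (φ : ℤ → k) (v : M) : Prop where
  ne_zero : v ≠ 0
  h_lie (a : k[T;T⁻¹]) : ⁅loopElt (h k) a, v⁆ = laurentAction k a φ 0 • v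
  e_lie (a : k[T;T⁻¹]) : ⁅loopElt (e k) a, v⁆ = 0

omit [Module k M] in
theorem e_lie_f_lie (a b : k[T;T⁻¹]) (m : M) :
    ⁅loopElt (e k) a, ⁅loopElt (f k) b, m⁆⁆ =
      ⁅loopElt (h k) (a * b), m⁆ + ⁅loopElt (f k) b, ⁅loopElt (e k) a, m⁆⁆ := by
  rw [leibniz_lie, lie_loopElt, lie_e_f]

variable [LieModule k (LoopSL2 k) M] [LieModule k (LoopSL2 k) M']

theorem h_lie_f_lie (a b : k[T;T⁻¹]) (m : M) :
    ⁅loopElt (h k) a, ⁅loopElt (f k) b, m⁆⁆ =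
      (-2 : k) • ⁅loopElt (f k) (a * b), m⁆ + ⁅loopElt (f k) b, ⁅loopElt (h k) a, m⁆⁆ := by
  rw [leibniz_lie, lie_loopElt, lie_h_f, loopElt_smul, smul_lie]

theorem lieSpan_le_of_lie_mem {K S : Submodule k M}
    (hh : ∀ a, ∀ m ∈ K, ⁅loopElt (h k) a, m⁆ ∈ K) (he : ∀ a, ∀ m ∈ K, ⁅loopElt (e k) a, m⁆ ∈ K)
    (hKS : K ≤ S) (hf : ∀ a, ∀ m ∈ S, ⁅loopElt (f k) a, m⁆ ∈ S) :
    (LieSubmodule.lieSpan k (LoopSL2 k) (K : Set M)).toSubmodule ≤ S := by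
  refine lieSpan_le_of_sup_eq_top borel_sup_range_loopElt_f (fun x hx m hm => ?_) hKS ?_
  · obtain ⟨_, ⟨a, rfl⟩, _, ⟨b, rfl⟩, rfl⟩ := Submodule.mem_sup.1 hx
    rw [add_lie]
    exact add_mem (hh a m hm) (he b m hm)
  · rintro _ ⟨a, rfl⟩
    exact hf a

variable (k M) in
/-- The eigenspace of `h ⊗ 1` for the eigenvalue `μ`. -/
def weightSpace (μ : k) : Submodule k M :=
  (LieModule.toEnd k (LoopSL2 k) M (loopElt (h k) 1)).eigenspace μ

theorem mem_weightSpace {μ : k} {m : M} : m ∈ weightSpace k M μ ↔ ⁅loopElt (h k) 1, m⁆ = μ • m :=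
  Module.End.mem_eigenspace_iff

variable (M) in
/-- The sum of the weight spaces lying strictly below the highest weight `φ`. The weights are those
of `h ⊗ 1`, which acts on a highest-weight vector by `φ 0` and whose eigenvalue each `f ⊗ a` lowers
by `2`. -/
def lower (φ : ℤ → k) : Submodule k M :=
  ⨆ n : ℕ, weightSpace k M (φ 0 - 2 * (n + 1))

theorem f_lie_mem_weightSpace {μ : k} {m : M} (hm : m ∈ weightSpace k M μ) (a : k[T;T⁻¹]) :
    ⁅loopElt (f k) a, m⁆ ∈ weightSpace k M (μ - 2) := by
  rw [mem_weightSpace] at hm ⊢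
  rw [h_lie_f_lie, one_mul, hm, lie_smul]
  module

theorem f_lie_mem_lower {φ : ℤ → k} {m : M} (hm : m ∈ lower M φ) (a : k[T;T⁻¹]) :
    ⁅loopElt (f k) a, m⁆ ∈ lower M φ := by
  suffices lower M φ ≤
      (lower M φ).comap (LieModule.toEnd k (LoopSL2 k) M (loopElt (f k) a)) from this hm
  refine iSup_le fun n m hm => Submodule.mem_iSup_of_mem (n + 1) ?_
  have hweight : φ 0 - 2 * ((n + 1 : ℕ) + 1) = φ 0 - 2 * ((n : k) + 1) - 2 := by
    push_cast
    ring
  exact hweight ▸ f_lie_mem_weightSpace hm a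

theorem map_mem_lower (g : M →ₗ⁅k,LoopSL2 k⁆ M') {φ : ℤ → k} {m : M} (hm : m ∈ lower M φ) :
    g m ∈ lower M' φ := by
  suffices lower M φ ≤ (lower M' φ).comap (g : M →ₗ[k] M') from this hm
  refine iSup_le fun n m hm => Submodule.mem_iSup_of_mem n ?_
  rw [mem_weightSpace] at hm ⊢
  change ⁅_, g m⁆ = _ • g m
  rw [← LieModuleHom.map_lie, hm, map_smul]

theorem disjoint_weightSpace_lower [CharZero k] (φ : ℤ → k) :
    Disjoint (weightSpace k M (φ 0)) (lower M φ) := by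
  refine (Module.End.eigenspaces_iSupIndep _ (φ 0)).mono_right (iSup_le fun n => ?_)
  exact le_iSup₂_of_le (φ 0 - 2 * (n + 1))
    (by simpa using (Nat.cast_add_one_ne_zero n : (n + 1 : k) ≠ 0)) le_rfl

variable (M) in
/-- The submodule of the vectors annihilated by all the `x ⊗ c b`. -/
def annihilatedBy (c : k[T;T⁻¹]) : LieSubmodule k (LoopSL2 k) M where
  carrier := {m | ∀ x b, ⁅loopElt x (c * b), m⁆ = 0}
  zero_mem' _ _ := lie_zero _
  add_mem' hm hn x b := by rw [lie_add, hm, hn, add_zero]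
  smul_mem' r m hm x b := by rw [lie_smul, hm, smul_zero]
  lie_mem {y m} hm := by
    induction y using loop_induction with
    | elt y a =>
      intro x b
      rw [leibniz_lie, lie_loopElt, hm, lie_zero, mul_assoc, hm, add_zero]
    | add y z hy hz =>
      intro x b
      rw [add_lie, lie_add, hy, hz, add_zero]

namespace IsHighestWeightVector

variable {φ : ℤ → k} {v : M}

theorem mem_weightSpace (hv : IsHighestWeightVector φ v) : v ∈ weightSpace k M (φ 0) := by
  simpa using ExpPolyLoop.mem_weightSpace.2 (hv.h_lie 1)

theorem notMem_lower [CharZero k] (hv : IsHighestWeightVector φ v) : v ∉ lower M φ :=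
  fun hlow => hv.ne_zero
    (Submodule.disjoint_def.1 (disjoint_weightSpace_lower φ) v hv.mem_weightSpace hlow)

theorem f_lie_mem_lower (hv : IsHighestWeightVector φ v) (a : k[T;T⁻¹]) :
    ⁅loopElt (f k) a, v⁆ ∈ lower M φ :=
  Submodule.mem_iSup_of_mem 0 (by simpa using f_lie_mem_weightSpace hv.mem_weightSpace a)

omit [LieModule k (LoopSL2 k) M] [LieModule k (LoopSL2 k) M'] in
theorem map {g : M →ₗ⁅k,LoopSL2 k⁆ M'} (hv : IsHighestWeightVector φ v) (hg : g v ≠ 0) :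
    IsHighestWeightVector φ (g v) where
  ne_zero := hg
  h_lie a := by rw [← LieModuleHom.map_lie, hv.h_lie, map_smul]
  e_lie a := by rw [← LieModuleHom.map_lie, hv.e_lie, map_zero]

theorem tmul {φ' : ℤ → k} {v' : M'} (hv : IsHighestWeightVector φ v)
    (hv' : IsHighestWeightVector φ' v') : IsHighestWeightVector (φ + φ') (v ⊗ₜ[k] v') where
  ne_zero := tmul_ne_zero hv.ne_zero hv'.ne_zero
  h_lie a := by
    rw [TensorProduct.LieModule.lie_tmul_right, hv.h_lie, hv'.h_lie, map_add, Pi.add_apply,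
      add_smul, TensorProduct.smul_tmul', TensorProduct.tmul_smul]
  e_lie a := by
    rw [TensorProduct.LieModule.lie_tmul_right, hv.e_lie, hv'.e_lie, TensorProduct.zero_tmul,
      TensorProduct.tmul_zero, add_zero]

theorem span_sup_lower (hv : IsHighestWeightVector φ v)
    (hgen : LieSubmodule.lieSpan k (LoopSL2 k) {v} = ⊤) : k ∙ v ⊔ lower M φ = ⊤ := by
  have hspan : LieSubmodule.lieSpan k (LoopSL2 k) ((k ∙ v : Submodule k M) : Set M) = ⊤ :=
    top_le_iff.1 (hgen ▸ LieSubmodule.lieSpan_mono (Submodule.subset_span (s := {v})))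
  rw [← top_le_iff, ← LieSubmodule.top_toSubmodule (R := k) (L := LoopSL2 k), ← hspan]
  refine lieSpan_le_of_lie_mem (fun a m hm => ?_) (fun a m hm => ?_) le_sup_left fun a m hm => ?_
  · obtain ⟨c, rfl⟩ := Submodule.mem_span_singleton.1 hm
    rw [lie_smul, hv.h_lie, smul_smul]
    exact Submodule.smul_mem _ _ (Submodule.mem_span_singleton_self v)
  · obtain ⟨c, rfl⟩ := Submodule.mem_span_singleton.1 hm
    rw [lie_smul, hv.e_lie, smul_zero]
    exact zero_mem _
  · obtain ⟨_, hc, l, hl, rfl⟩ := Submodule.mem_sup.1 hm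
    obtain ⟨c, rfl⟩ := Submodule.mem_span_singleton.1 hc
    rw [lie_add, lie_smul]
    exact Submodule.mem_sup_right (add_mem (Submodule.smul_mem _ c (hv.f_lie_mem_lower a))
      (ExpPolyLoop.f_lie_mem_lower hl a))

theorem exists_sub_smul_mem_lower (hv : IsHighestWeightVector φ v)
    (hgen : LieSubmodule.lieSpan k (LoopSL2 k) {v} = ⊤) (m : M) :
    ∃ c : k, m - c • v ∈ lower M φ := by
  obtain ⟨_, hc, l, hl, rfl⟩ := Submodule.mem_sup.1
    (hv.span_sup_lower hgen ▸ Submodule.mem_top : m ∈ k ∙ v ⊔ lower M φ)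
  obtain ⟨c, rfl⟩ := Submodule.mem_span_singleton.1 hc
  exact ⟨c, by simpa using hl⟩

theorem le_lower [CharZero k] (hv : IsHighestWeightVector φ v)
    (hgen : LieSubmodule.lieSpan k (LoopSL2 k) {v} = ⊤) {N : LieSubmodule k (LoopSL2 k) M}
    (hN : N ≠ ⊤) : N.toSubmodule ≤ lower M φ := by
  let π := LieSubmodule.Quotient.mk' N
  have hvN : π v ≠ 0 := fun h0 => hN <| by
    rw [← top_le_iff, ← hgen, LieSubmodule.lieSpan_le, Set.singleton_subset_iff]
    exact (LieSubmodule.Quotient.mk_eq_zero N).1 h0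
  intro n hn
  obtain ⟨c, hc⟩ := hv.exists_sub_smul_mem_lower hgen n
  have hπ : -(c • π v) ∈ lower (M ⧸ N) φ := by
    have hn0 : π n = 0 := (LieSubmodule.Quotient.mk_eq_zero N).2 hn
    simpa only [map_sub, map_smul, hn0, zero_sub] using map_mem_lower π hc
  have hc0 : c = 0 := by
    by_contra hc0
    exact (hv.map hvN).notMem_lower
      ((Submodule.smul_mem_iff _ hc0).1 ((Submodule.neg_mem_iff _).1 hπ))
  simpa [hc0] using hc

section Irreducible

variable [CharZero k] [LieModule.IsIrreducible k (LoopSL2 k) M]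

theorem eq_bot_of_le_lower (hv : IsHighestWeightVector φ v) {K : Submodule k M}
    (hh : ∀ a, ∀ m ∈ K, ⁅loopElt (h k) a, m⁆ ∈ K) (he : ∀ a, ∀ m ∈ K, ⁅loopElt (e k) a, m⁆ ∈ K)
    (hK : K ≤ lower M φ) : K = ⊥ := by
  have hspan := lieSpan_le_of_lie_mem hh he hK fun a m hm => ExpPolyLoop.f_lie_mem_lower hm a
  have hbot : LieSubmodule.lieSpan k (LoopSL2 k) (K : Set M) = ⊥ :=
    (eq_bot_or_eq_top _).resolve_right fun htop =>
      hv.notMem_lower (hspan (htop ▸ LieSubmodule.mem_top v))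
  exact (Submodule.eq_bot_iff K).2 ((LieSubmodule.lieSpan_eq_bot_iff k (LoopSL2 k) M).1 hbot)

theorem f_lie_eq_zero (hv : IsHighestWeightVector φ v) {c : k[T;T⁻¹]}
    (hc : laurentAction k c φ = 0) (b : k[T;T⁻¹]) : ⁅loopElt (f k) (c * b), v⁆ = 0 := by
  -- The vectors `(f ⊗ cb) v` form a subspace stable under `h ⊗ a` and `e ⊗ a`: the latter map
  -- `(f ⊗ cb) v` to the multiple `(abc · φ)(0) v = 0` of `v`.
  have hcb (b : k[T;T⁻¹]) : laurentAction k (c * b) φ 0 = 0 := by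
    rw [mul_comm, map_mul, Module.End.mul_apply, hc, map_zero, Pi.zero_apply]
  let K : Submodule k M := LinearMap.range
    ((LieModule.toEnd k (LoopSL2 k) M : LoopSL2 k →ₗ[k] Module.End k M).flip v ∘ₗ
      loopElt (f k) ∘ₗ LinearMap.mulLeft k c)
  have hK : K = ⊥ := by
    refine hv.eq_bot_of_le_lower ?_ ?_ ?_
    · rintro a _ ⟨b, rfl⟩
      change ⁅loopElt (h k) a, ⁅loopElt (f k) (c * b), v⁆⁆ ∈ K
      rw [h_lie_f_lie, hv.h_lie, lie_smul, mul_left_comm]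
      exact add_mem (K.smul_mem _ ⟨a * b, rfl⟩) (K.smul_mem _ ⟨b, rfl⟩)
    · rintro a _ ⟨b, rfl⟩
      change ⁅loopElt (e k) a, ⁅loopElt (f k) (c * b), v⁆⁆ ∈ K
      rw [e_lie_f_lie, hv.e_lie, lie_zero, add_zero, hv.h_lie, mul_left_comm, hcb, zero_smul]
      exact K.zero_mem
    · rintro _ ⟨b, rfl⟩
      exact hv.f_lie_mem_lower (c * b)
  exact (Submodule.eq_bot_iff K).1 hK _ ⟨b, rfl⟩

theorem lie_eq_zero (hv : IsHighestWeightVector φ v) {c : k[T;T⁻¹]}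
    (hc : laurentAction k c φ = 0) (x : SL2 k) (b : k[T;T⁻¹]) (m : M) :
    ⁅loopElt x (c * b), m⁆ = 0 := by
  have hmem : v ∈ annihilatedBy M c := fun x b => by
    rw [sl2_eq x, loopElt_add, loopElt_add, loopElt_smul, loopElt_smul, loopElt_smul, add_lie,
      add_lie, smul_lie, smul_lie, smul_lie, hv.h_lie, hv.e_lie, hv.f_lie_eq_zero hc, mul_comm,
      map_mul, Module.End.mul_apply, hc, map_zero, Pi.zero_apply, zero_smul]
    simp only [smul_zero, add_zero]
  have htop : annihilatedBy M c = ⊤ := (eq_bot_or_eq_top _).resolve_left fun hbot =>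
    hv.ne_zero ((LieSubmodule.mem_bot v).1 (hbot ▸ hmem))
  exact (htop ▸ LieSubmodule.mem_top m : m ∈ annihilatedBy M c) x b

theorem exists_eq_smul (hv : IsHighestWeightVector φ v) (g : M →ₗ⁅k,LoopSL2 k⁆ M) :
    ∃ c : k, ∀ m, g m = c • m := by
  have hgen : LieSubmodule.lieSpan k (LoopSL2 k) {v} = ⊤ :=
    (eq_bot_or_eq_top _).resolve_left fun hbot => hv.ne_zero
      ((LieSubmodule.lieSpan_eq_bot_iff k (LoopSL2 k) M).1 hbot v rfl)
  obtain ⟨c, hc⟩ := hv.exists_sub_smul_mem_lower hgen (g v)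
  have hweight : g v - c • v ∈ weightSpace k M (φ 0) := by
    refine sub_mem (ExpPolyLoop.mem_weightSpace.2 ?_) (Submodule.smul_mem _ c hv.mem_weightSpace)
    rw [← LieModuleHom.map_lie, ExpPolyLoop.mem_weightSpace.1 hv.mem_weightSpace, map_smul]
  have hgv : v ∈ (g - c • LieModuleHom.id).ker := LieModuleHom.mem_ker.2
    (Submodule.disjoint_def.1 (disjoint_weightSpace_lower φ) _ hweight hc)
  have htop : (g - c • LieModuleHom.id).ker = ⊤ := (eq_bot_or_eq_top _).resolve_left fun hbot =>
    hv.ne_zero ((LieSubmodule.mem_bot v).1 (hbot ▸ hgv))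
  exact ⟨c, fun m => sub_eq_zero.1 (LieModuleHom.mem_ker.1 (htop ▸ LieSubmodule.mem_top m))⟩

end Irreducible

end IsHighestWeightVector

end HighestWeight

/-! ### The Fock space -/

section SymmetricAlgebra

variable {k V : Type*} [CommRing k] [AddCommGroup V] [Module k V]

open SymmetricAlgebra (ι)

open scoped IsMulCommutative in
theorem exists_symmetricAlgebra_algHom {R : Type*} [Ring R] [Algebra k R] (g : V →ₗ[k] R)
    (hg : ∀ x y, g x * g y = g y * g x) :
    ∃ G : SymmetricAlgebra k V →ₐ[k] R, ∀ x, G (ι k V x) = g x := by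
  let S := Algebra.adjoin k (Set.range g)
  have hcomm : ∀ a ∈ Set.range g, ∀ b ∈ Set.range g, a * b = b * a := by
    rintro _ ⟨x, rfl⟩ _ ⟨y, rfl⟩
    exact hg x y
  have : IsMulCommutative S := Algebra.isMulCommutative_adjoin k hcomm
  let g' : V →ₗ[k] S :=
    g.codRestrict (Subalgebra.toSubmodule S) fun x => Algebra.subset_adjoin ⟨x, rfl⟩
  exact ⟨S.val.comp (SymmetricAlgebra.lift g'), fun x =>
    congrArg S.val (SymmetricAlgebra.lift_ι_apply (f := g') x)⟩

theorem exists_end_symmetricAlgebra (N : V →ₗ[k] Module.End k (SymmetricAlgebra k V))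
    (hN : ∀ x y q, N x (ι k V y * q) - ι k V y * N x q = N y (ι k V x * q) - ι k V x * N y q)
    (p : SymmetricAlgebra k V) :
    ∃ S : Module.End k (SymmetricAlgebra k V),
      S 1 = p ∧ ∀ x q, S (ι k V x * q) = ι k V x * S q + N x q := by
  let P := SymmetricAlgebra k V
  -- The matrices `[[x, N x], [0, x]]` on `P × P` commute by `hN`, so they extend to an action of
  -- the algebra `P`; the upper right corner of that action is a solution `S` with `S 1 = 0`, and
  -- applying it to `(p, 1)` instead of `(0, 1)` gives `S 1 = p`.
  let g : V →ₗ[k] Module.End k (P × P) :=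
    { toFun x := (LinearMap.mulLeft k (ι k V x) ∘ₗ .fst k P P + N x ∘ₗ .snd k P P).prod
        (LinearMap.mulLeft k (ι k V x) ∘ₗ .snd k P P)
      map_add' x y := by ext <;> simp [add_mul]
      map_smul' c x := by ext <;> simp }
  have g_apply (x : V) (q r : P) : g x (q, r) = (ι k V x * q + N x r, ι k V x * r) := rfl
  obtain ⟨G, hG⟩ := exists_symmetricAlgebra_algHom g fun x y => by
    refine LinearMap.ext fun ⟨q, r⟩ => ?_
    have hxy := hN x y r
    simp only [Module.End.mul_apply, g_apply, Prod.mk.injEq]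
    constructor <;> grind
  have G_ι_mul (x : V) (q : P) : G (ι k V x * q) (p, 1) = g x (G q (p, 1)) := by
    rw [map_mul, hG, Module.End.mul_apply]
  have G_snd (q : P) : ∀ z : P × P, (G q z).2 = q * z.2 := by
    induction q using SymmetricAlgebra.induction with
    | algebraMap r =>
      intro z
      rw [AlgHom.commutes, Module.algebraMap_end_apply, Prod.smul_snd, Algebra.smul_def]
    | ι x => intro z; rw [hG, g_apply]
    | mul a b ha hb => intro z; rw [map_mul, Module.End.mul_apply, ha, hb, mul_assoc]
    | add a b ha hb => intro z; rw [map_add, LinearMap.add_apply, Prod.snd_add, ha, hb, add_mul]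
  refine ⟨LinearMap.fst k P P ∘ₗ G.toLinearMap.flip (p, 1), ?_, fun x q => ?_⟩
  · change (G 1 (p, 1)).1 = p
    rw [map_one, Module.End.one_apply]
  · change (G (ι k V x * q) (p, 1)).1 = ι k V x * (G q (p, 1)).1 + N x q
    rw [G_ι_mul, g_apply, G_snd, mul_one]

theorem symmetricAlgebra_end_ext {S S' : Module.End k (SymmetricAlgebra k V)} (h1 : S 1 = S' 1)
    (hι : ∀ x q, S q = S' q → S (ι k V x * q) = S' (ι k V x * q)) : S = S' := by
  have hmul (q : SymmetricAlgebra k V) : ∀ r, S r = S' r → S (q * r) = S' (q * r) := by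
    induction q using SymmetricAlgebra.induction with
    | algebraMap c => intro r hr; rw [← Algebra.smul_def, map_smul, map_smul, hr]
    | ι x => exact hι x
    | mul a b ha hb => intro r hr; rw [mul_assoc]; exact ha _ (hb r hr)
    | add a b ha hb => intro r hr; rw [add_mul, map_add, map_add, ha r hr, hb r hr]
  exact LinearMap.ext fun q => mul_one q ▸ hmul q 1 h1

theorem exists_linearMap_end_symmetricAlgebra {W : Type*} [AddCommGroup W] [Module k W]
    (p : W →ₗ[k] SymmetricAlgebra k V) (N : W →ₗ[k] V →ₗ[k] Module.End k (SymmetricAlgebra k V))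
    (hN : ∀ w x y q,
      N w x (ι k V y * q) - ι k V y * N w x q = N w y (ι k V x * q) - ι k V x * N w y q) :
    ∃ S : W →ₗ[k] Module.End k (SymmetricAlgebra k V),
      (∀ w, S w 1 = p w) ∧ ∀ w x q, S w (ι k V x * q) = ι k V x * S w q + N w x q := by
  choose S S_one S_ι_mul using fun w => exists_end_symmetricAlgebra (N w) (hN w) (p w)
  refine ⟨{ toFun := S, map_add' := fun w w' => ?_, map_smul' := fun c w => ?_ },
    S_one, S_ι_mul⟩
  · refine symmetricAlgebra_end_ext ?_ fun x q hq => ?_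
    · simp only [LinearMap.add_apply, S_one, map_add]
    · simp only [LinearMap.add_apply, S_ι_mul, map_add] at hq ⊢
      rw [hq]
      ring
  · refine symmetricAlgebra_end_ext ?_ fun x q hq => ?_
    · simp only [LinearMap.smul_apply, S_one, map_smul, RingHom.id_apply]
    · simp only [LinearMap.smul_apply, S_ι_mul, map_smul, RingHom.id_apply] at hq ⊢
      rw [hq, smul_add, mul_smul_comm]

end SymmetricAlgebra

section Fock

variable {k A : Type*} [CommRing k] [CommRing A] [Algebra k A]

open SymmetricAlgebra (ι)

theorem exists_fockH (χ : A →ₗ[k] k) :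
    ∃ H : A →ₗ[k] Module.End k (SymmetricAlgebra k A), (∀ a, H a 1 = χ a • 1) ∧
      ∀ a b q, H a (ι k A b * q) = ι k A b * H a q + (-2 : k) • (ι k A (a * b) * q) := by
  refine exists_linearMap_end_symmetricAlgebra (χ.smulRight 1)
    ((LinearMap.mul k A).compr₂ ((-2 : k) • LinearMap.mul k (SymmetricAlgebra k A) ∘ₗ ι k A))
    fun a b c q => ?_
  simp only [LinearMap.compr₂_apply, LinearMap.smul_apply, LinearMap.comp_apply,
    LinearMap.mul_apply', mul_smul_comm, mul_left_comm, sub_self]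

/-- The operator by which `h ⊗ a` acts on the Fock space `Sym A`. Here `f ⊗ b` acts as
multiplication by `b`, so the relation `[h ⊗ a, f ⊗ b] = -2 f ⊗ ab` and the value `χ a` at the
vacuum `1` determine the operator. -/
def fockH (χ : A →ₗ[k] k) : A →ₗ[k] Module.End k (SymmetricAlgebra k A) :=
  (exists_fockH χ).choose

theorem fockH_one (χ : A →ₗ[k] k) (a : A) : fockH χ a 1 = χ a • 1 :=
  (exists_fockH χ).choose_spec.1 a

theorem fockH_ι_mul (χ : A →ₗ[k] k) (a b : A) (q : SymmetricAlgebra k A) :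
    fockH χ a (ι k A b * q) = ι k A b * fockH χ a q + (-2 : k) • (ι k A (a * b) * q) :=
  (exists_fockH χ).choose_spec.2 a b q

theorem exists_fockE (χ : A →ₗ[k] k) :
    ∃ E : A →ₗ[k] Module.End k (SymmetricAlgebra k A), (∀ a, E a 1 = 0) ∧
      ∀ a b q, E a (ι k A b * q) = ι k A b * E a q + fockH χ (a * b) q := by
  refine exists_linearMap_end_symmetricAlgebra 0 ((LinearMap.mul k A).compr₂ (fockH χ))
    fun a b c q => ?_
  simp only [LinearMap.compr₂_apply, LinearMap.mul_apply', fockH_ι_mul, add_sub_cancel_left,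
    mul_right_comm a b c]

/-- The operator by which `e ⊗ a` acts on the Fock space `Sym A`: it kills the vacuum `1` and
satisfies `[e ⊗ a, f ⊗ b] = h ⊗ ab`, where `f ⊗ b` acts as multiplication by `b`. -/
def fockE (χ : A →ₗ[k] k) : A →ₗ[k] Module.End k (SymmetricAlgebra k A) :=
  (exists_fockE χ).choose

theorem fockE_one (χ : A →ₗ[k] k) (a : A) : fockE χ a 1 = 0 :=
  (exists_fockE χ).choose_spec.1 a

theorem fockE_ι_mul (χ : A →ₗ[k] k) (a b : A) (q : SymmetricAlgebra k A) :
    fockE χ a (ι k A b * q) = ι k A b * fockE χ a q + fockH χ (a * b) q :=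
  (exists_fockE χ).choose_spec.2 a b q

variable (χ : A →ₗ[k] k) (a b : A)

theorem fockH_comm (q : SymmetricAlgebra k A) :
    fockH χ a (fockH χ b q) = fockH χ b (fockH χ a q) := by
  suffices fockH χ a * fockH χ b = fockH χ b * fockH χ a from congr($this q)
  refine symmetricAlgebra_end_ext ?_ fun c q hq => ?_
  · simp only [Module.End.mul_apply, fockH_one, map_smul]
    exact smul_comm _ _ _
  · simp only [Module.End.mul_apply, fockH_ι_mul, map_add, map_smul, mul_left_comm b a c] at hq ⊢
    rw [hq]
    module

theorem fockH_fockE (q : SymmetricAlgebra k A) :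
    fockH χ a (fockE χ b q) = fockE χ b (fockH χ a q) + (2 : k) • fockE χ (a * b) q := by
  suffices fockH χ a * fockE χ b = fockE χ b * fockH χ a + (2 : k) • fockE χ (a * b) from
    congr($this q)
  refine symmetricAlgebra_end_ext ?_ fun c q hq => ?_
  · simp only [Module.End.mul_apply, LinearMap.add_apply, LinearMap.smul_apply, fockH_one,
      fockE_one, map_smul, map_zero, smul_zero, add_zero]
  · simp only [Module.End.mul_apply, LinearMap.add_apply, LinearMap.smul_apply, fockH_ι_mul,
      fockE_ι_mul, map_add, map_smul, mul_left_comm b a c, mul_assoc, fockH_comm χ a] at hq ⊢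
    rw [hq, mul_add, mul_smul_comm]
    module

theorem fockE_comm (q : SymmetricAlgebra k A) :
    fockE χ a (fockE χ b q) = fockE χ b (fockE χ a q) := by
  suffices fockE χ a * fockE χ b = fockE χ b * fockE χ a from congr($this q)
  refine symmetricAlgebra_end_ext ?_ fun c q hq => ?_
  · simp only [Module.End.mul_apply, fockE_one, map_zero]
  · simp only [Module.End.mul_apply, fockE_ι_mul, map_add, fockH_fockE] at hq ⊢
    rw [hq, mul_right_comm a c b, mul_right_comm b c a, mul_comm b a]
    abel

end Fock

section FockRepresentation

universe u

variable {k : Type u} [Field k] (χ : k[T;T⁻¹] →ₗ[k] k)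

open SymmetricAlgebra (ι)

/-- The action of the loop algebra on the Fock space `Sym k[t, t⁻¹]`, in which `f ⊗ a` acts as
multiplication by `a`. -/
def fockRep : LoopSL2 k →ₗ[k] Module.End k (SymmetricAlgebra k k[T;T⁻¹]) :=
  TensorProduct.lift (LinearMap.mk₂ k
    (fun (a : k[T;T⁻¹]) (x : SL2 k) => x.1 0 0 • fockH χ a + x.1 0 1 • fockE χ a +
      x.1 1 0 • LinearMap.mulLeft k (ι k _ a))
    (fun a b x => by
      ext q
      simp only [map_add, smul_add, LinearMap.add_apply, LinearMap.smul_apply,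
        LinearMap.mulLeft_apply, add_mul]
      module)
    (fun c a x => by
      ext q
      simp only [map_smul, LinearMap.add_apply, LinearMap.smul_apply, LinearMap.mulLeft_apply,
        smul_mul_assoc, smul_add]
      module)
    (fun a x y => by
      ext q
      simp only [AddMemClass.coe_add, Matrix.add_apply, LinearMap.add_apply,
        LinearMap.smul_apply, LinearMap.mulLeft_apply]
      module)
    (fun c a x => by
      ext q
      simp only [SetLike.val_smul, Matrix.smul_apply, smul_eq_mul, LinearMap.add_apply,
        LinearMap.smul_apply, LinearMap.mulLeft_apply, smul_add]
      module))

theorem fockRep_loopElt (x : SL2 k) (a : k[T;T⁻¹]) (q : SymmetricAlgebra k k[T;T⁻¹]) :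
    fockRep χ (loopElt x a) q =
      x.1 0 0 • fockH χ a q + x.1 0 1 • fockE χ a q + x.1 1 0 • (ι k _ a * q) :=
  LinearMap.congr_fun (TensorProduct.lift.tmul a x) q

theorem fockRep_lie (y z : LoopSL2 k) :
    fockRep χ ⁅y, z⁆ = fockRep χ y * fockRep χ z - fockRep χ z * fockRep χ y := by
  induction y using loop_induction with
  | add y y' hy hy' => rw [add_lie, map_add, map_add, hy, hy', add_mul, mul_add]; abel
  | elt x a =>
    induction z using loop_induction with
    | add z z' hz hz' => rw [lie_add, map_add, map_add, hz, hz', add_mul, mul_add]; abel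
    | elt y b =>
      refine LinearMap.ext fun q => ?_
      rw [lie_loopElt]
      simp only [fockRep_loopElt, LinearMap.sub_apply, Module.End.mul_apply, map_add, map_smul,
        fockH_ι_mul, fockE_ι_mul, fockH_fockE, fockH_comm χ b a, fockE_comm χ b a, mul_comm b a,
        mul_left_comm (ι k _ b) (ι k _ a) q, LieAlgebra.SpecialLinear.sl_bracket,
        Matrix.sub_apply, Matrix.mul_apply, Fin.sum_univ_two, sl2_apply_one_one]
      module

theorem exists_isHighestWeightVector (φ : ℤ → k) :
    ∃ (M : Type u) (_ : AddCommGroup M) (_ : Module k M) (_ : LieRingModule (LoopSL2 k) M)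
      (_ : LieModule k (LoopSL2 k) M) (v : M), IsHighestWeightVector φ v := by
  let χ : k[T;T⁻¹] →ₗ[k] k :=
    LinearMap.proj 0 ∘ₗ LinearMap.applyₗ φ ∘ₗ (laurentAction k).toLinearMap
  let P := SymmetricAlgebra k k[T;T⁻¹]
  let : LieRingModule (LoopSL2 k) P :=
    { bracket x q := fockRep χ x q
      add_lie x y q := congr($(map_add (fockRep χ) x y) q)
      lie_add x := map_add (fockRep χ x)
      leibniz_lie x y q := by
        change fockRep χ x (fockRep χ y q) = fockRep χ ⁅x, y⁆ q + fockRep χ y (fockRep χ x q)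
        rw [fockRep_lie]
        exact (sub_add_cancel _ _).symm }
  have : LieModule k (LoopSL2 k) P :=
    { smul_lie c x q := congr($(map_smul (fockRep χ) c x) q)
      lie_smul c x := map_smul (fockRep χ x) c }
  have hbracket (x : LoopSL2 k) (q : P) : ⁅x, q⁆ = fockRep χ x q := rfl
  refine ⟨P, _, _, _, this, 1, one_ne_zero, fun a => ?_, fun a => ?_⟩
  · rw [hbracket, fockRep_loopElt, fockH_one]
    simp [h, χ]
  · rw [hbracket, fockRep_loopElt, fockE_one]
    simp [e]

end FockRepresentation

/-! ### Induced modules -/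

section InducedModule

variable {k L : Type*} [Field k] [LieRing L] [LieAlgebra k L]

attribute [local instance] LieRing.ofAssociativeRing

theorem universalEnveloping_induction {C : UniversalEnvelopingAlgebra k L → Prop}
    (u : UniversalEnvelopingAlgebra k L)
    (algebraMap : ∀ r, C (algebraMap k (UniversalEnvelopingAlgebra k L) r))
    (ι : ∀ x, C (UniversalEnvelopingAlgebra.ι k x)) (mul : ∀ a b, C a → C b → C (a * b))
    (add : ∀ a b, C a → C b → C (a + b)) : C u := by
  obtain ⟨t, rfl⟩ : ∃ t, UniversalEnvelopingAlgebra.mkAlgHom k L t = u :=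
    RingCon.mkₐ_surjective _ u
  induction t using TensorAlgebra.induction with
  | algebraMap r => rw [AlgHom.commutes]; exact algebraMap r
  | ι x => exact ι x
  | mul a b ha hb => rw [map_mul]; exact mul _ _ ha hb
  | add a b ha hb => rw [map_add]; exact add _ _ ha hb

variable (B : LieSubalgebra k L) (χ : LieAlgebra.LieCharacter k B)
  {M : Type*} [AddCommGroup M] [Module k M] [LieRingModule L M] [LieModule k L M]

namespace Induced

/-- The canonical generator `1 ⊗ 1` of the induced module. -/
def gen : Induced B χ := Submodule.Quotient.mk 1

theorem lie_gen (x : B) : ⁅(x : L), gen B χ⁆ = χ x • gen B χ := by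
  rw [← algebraMap_smul (UniversalEnvelopingAlgebra k L) (χ x) (gen B χ)]
  change UniversalEnvelopingAlgebra.ι k (x : L) • gen B χ = _
  rw [← sub_eq_zero, ← sub_smul]
  refine (Submodule.Quotient.mk_eq_zero _).2 (Submodule.subset_span ⟨x, ?_⟩)
  exact (mul_one _).symm

theorem exists_smul_gen_eq (m : Induced B χ) :
    ∃ u : UniversalEnvelopingAlgebra k L, u • gen B χ = m := by
  obtain ⟨u, rfl⟩ := Submodule.Quotient.mk_surjective _ m
  exact ⟨u, congrArg Submodule.Quotient.mk (mul_one u)⟩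

variable {B χ}

theorem smul_mem (N : LieSubmodule k L (Induced B χ)) (u : UniversalEnvelopingAlgebra k L) :
    ∀ m ∈ N, u • m ∈ N := by
  induction u using universalEnveloping_induction with
  | algebraMap r => intro m hm; rw [algebraMap_smul]; exact N.smul_mem r hm
  | ι x => exact fun m hm => N.lie_mem hm
  | mul a b ha hb => intro m hm; rw [mul_smul]; exact ha _ (hb m hm)
  | add a b ha hb => intro m hm; rw [add_smul]; exact add_mem (ha m hm) (hb m hm)

variable (B χ) in
theorem lieSpan_gen : LieSubmodule.lieSpan k L {gen B χ} = ⊤ := by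
  rw [eq_top_iff]
  rintro m -
  obtain ⟨u, rfl⟩ := exists_smul_gen_eq B χ m
  exact smul_mem _ u _ (LieSubmodule.subset_lieSpan rfl)

theorem exists_hom {v : M} (hv : ∀ x : B, ⁅(x : L), v⁆ = χ x • v) :
    ∃ F : Induced B χ →ₗ⁅k,L⁆ M, F (gen B χ) = v := by
  let U := UniversalEnvelopingAlgebra k L
  let ρ : U →ₐ[k] Module.End k M := UniversalEnvelopingAlgebra.lift k (LieModule.toEnd k L M)
  let : Module U M := Module.compHom M ρ.toRingHom
  have ι_smul (x : L) (m : M) : UniversalEnvelopingAlgebra.ι k x • m = ⁅x, m⁆ :=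
    congr($(UniversalEnvelopingAlgebra.lift_ι_apply k (LieModule.toEnd k L M) x) m)
  have algebraMap_smul' (c : k) (m : M) : algebraMap k U c • m = c • m :=
    congr($(ρ.commutes c) m)
  let F : Induced B χ →ₗ[U] M :=
    Submodule.liftQ _ (LinearMap.toSpanSingleton U M v) <| Submodule.span_le.2 <| by
      rintro _ ⟨x, rfl⟩
      change (UniversalEnvelopingAlgebra.ι k (x : L) - algebraMap k U (χ x)) • v = 0
      rw [sub_smul, ι_smul, hv, algebraMap_smul', sub_self]
  refine ⟨{ toFun := F, map_add' := F.map_add, map_smul' := fun c m => ?_, map_lie' := ?_ }, ?_⟩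
  · rw [← algebraMap_smul U c m, F.map_smul, algebraMap_smul']
    rfl
  · exact fun {x m} => (F.map_smul _ m).trans (ι_smul x _)
  · exact one_smul U v

end Induced

end InducedModule

section Verma

universe u

variable {k : Type u} [Field k]

/-- The canonical generator of the Verma module. -/
abbrev vermaGen (φ : ℤ → k) : Verma φ := Induced.gen (borel k) (weightCharacter φ)

theorem exists_verma_hom {M : Type*} [AddCommGroup M] [Module k M]
    [LieRingModule (LoopSL2 k) M] [LieModule k (LoopSL2 k) M] {φ : ℤ → k} {v : M}
    (hv : IsHighestWeightVector φ v) :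
    ∃ F : Verma φ →ₗ⁅k,LoopSL2 k⁆ M, F (vermaGen φ) = v := by
  refine Induced.exists_hom ?_
  rintro ⟨x, hx⟩
  obtain ⟨_, ⟨a, rfl⟩, _, ⟨b, rfl⟩, rfl⟩ := Submodule.mem_sup.1 hx
  change ⁅loopElt (h k) a + loopElt (e k) b, v⁆ =
    weightFunctional φ (loopElt (h k) a + loopElt (e k) b) • v
  rw [add_lie, hv.h_lie, hv.e_lie, map_add, weightFunctional_h, weightFunctional_e, add_zero,
    add_zero]

theorem vermaGen_ne_zero (φ : ℤ → k) : vermaGen φ ≠ 0 := by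
  obtain ⟨M, _, _, _, _, v, hv⟩ := exists_isHighestWeightVector φ
  obtain ⟨F, hF⟩ := exists_verma_hom hv
  exact fun h0 => hv.ne_zero (by rw [← hF, h0, map_zero])

theorem isHighestWeightVector_vermaGen (φ : ℤ → k) :
    IsHighestWeightVector φ (vermaGen φ) where
  ne_zero := vermaGen_ne_zero φ
  h_lie a := by
    rw [← weightFunctional_h]
    exact Induced.lie_gen (borel k) _ ⟨loopElt (h k) a, Submodule.mem_sup_left ⟨a, rfl⟩⟩
  e_lie a := by
    rw [← zero_smul k, ← weightFunctional_e φ a]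
    exact Induced.lie_gen (borel k) _ ⟨loopElt (e k) a, Submodule.mem_sup_right ⟨a, rfl⟩⟩

variable [CharZero k]

theorem vermaGen_notMem_sumProper (φ : ℤ → k) :
    vermaGen φ ∉ sumProper k (LoopSL2 k) (Verma φ) := by
  have hv := isHighestWeightVector_vermaGen φ
  suffices (sumProper k (LoopSL2 k) (Verma φ)).toSubmodule ≤ lower (Verma φ) φ from
    fun hmem => hv.notMem_lower (this hmem)
  rw [sumProper, LieSubmodule.sSup_toSubmodule]
  refine sSup_le ?_
  rintro _ ⟨N, hN, rfl⟩
  exact hv.le_lower (Induced.lieSpan_gen _ _) hN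

theorem sumProper_verma_ne_top (φ : ℤ → k) : sumProper k (LoopSL2 k) (Verma φ) ≠ ⊤ :=
  fun htop => vermaGen_notMem_sumProper φ (htop ▸ LieSubmodule.mem_top _)

theorem isIrreducible_irred (φ : ℤ → k) : LieModule.IsIrreducible k (LoopSL2 k) (Irred φ) :=
  isIrreducible_quotient_sumProper (sumProper_verma_ne_top φ)

theorem exists_isHighestWeightVector_irred (φ : ℤ → k) :
    ∃ v : Irred φ, IsHighestWeightVector φ v :=
  ⟨LieSubmodule.Quotient.mk' _ (vermaGen φ), (isHighestWeightVector_vermaGen φ).map fun h0 =>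
    vermaGen_notMem_sumProper φ ((LieSubmodule.Quotient.mk_eq_zero _).1 h0)⟩

theorem nonempty_irred_equiv {M : Type*} [AddCommGroup M] [Module k M]
    [LieRingModule (LoopSL2 k) M] [LieModule k (LoopSL2 k) M]
    [LieModule.IsIrreducible k (LoopSL2 k) M] {φ : ℤ → k} {v : M}
    (hv : IsHighestWeightVector φ v) : Nonempty (Irred φ ≃ₗ⁅k,LoopSL2 k⁆ M) := by
  obtain ⟨F, rfl⟩ := exists_verma_hom hv
  refine nonempty_quotient_sumProper_equiv (sumProper_verma_ne_top φ) (F := F) ?_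
  rintro rfl
  exact hv.ne_zero rfl

end Verma

section CharPoly

variable {k : Type*} [Field k]

theorem laurentAction_charPoly (φ : ℤ → k) :
    laurentAction k (Polynomial.toLaurent (charPoly φ)) φ = 0 :=
  (annihilator φ).mul_mem_left _ (Submodule.IsPrincipal.generator_mem (annihilator φ))

variable [CharZero k]
  {M₁ : Type*} [AddCommGroup M₁] [Module k M₁] [LieRingModule (LoopSL2 k) M₁]
  [LieModule k (LoopSL2 k) M₁] [LieModule.IsIrreducible k (LoopSL2 k) M₁]
  {M₂ : Type*} [AddCommGroup M₂] [Module k M₂] [LieRingModule (LoopSL2 k) M₂]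
  [LieModule k (LoopSL2 k) M₂] [LieModule.IsIrreducible k (LoopSL2 k) M₂]

theorem IsHighestWeightVector.actIndependently {φ₁ φ₂ : ℤ → k} {v₁ : M₁} {v₂ : M₂}
    (hv₁ : IsHighestWeightVector φ₁ v₁) (hv₂ : IsHighestWeightVector φ₂ v₂) {c₁ c₂ : k[T;T⁻¹]}
    (hc₁ : laurentAction k c₁ φ₁ = 0) (hc₂ : laurentAction k c₂ φ₂ = 0) (hcop : IsCoprime c₁ c₂) :
    ActIndependently (LoopSL2 k) M₁ M₂ := by
  obtain ⟨u₁, u₂, hu⟩ := hcop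
  intro z
  induction z using loop_induction with
  | elt x b =>
    have hb : c₂ * (u₂ * b) = b - c₁ * (u₁ * b) := by linear_combination b * hu
    refine ⟨loopElt x (c₂ * (u₂ * b)), fun m => ?_, hv₂.lie_eq_zero hc₂ x _⟩
    rw [hb, map_sub, sub_lie, hv₁.lie_eq_zero hc₁, sub_zero]
  | add z z' hz hz' =>
    obtain ⟨y, hy₁, hy₂⟩ := hz
    obtain ⟨y', hy₁', hy₂'⟩ := hz'
    exact ⟨y + y', fun m => by rw [add_lie, add_lie, hy₁, hy₁'],
      fun m => by rw [add_lie, hy₂, hy₂', add_zero]⟩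

end CharPoly

end ExpPolyLoop

end

open ExpPolyLoop in
theorem mainTheorem5_general {k : Type*} [Field k] [CharZero k] (φ₁ φ₂ : ℤ → k)
    (hcop : IsCoprime (charPoly φ₁) (charPoly φ₂)) :
    Nonempty (Irred (φ₁ + φ₂) ≃ₗ⁅k,LoopSL2 k⁆ Irred φ₁ ⊗[k] Irred φ₂) := by
  have := isIrreducible_irred φ₁
  have := isIrreducible_irred φ₂
  obtain ⟨v₁, hv₁⟩ := exists_isHighestWeightVector_irred φ₁
  obtain ⟨v₂, hv₂⟩ := exists_isHighestWeightVector_irred φ₂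
  have hind : ActIndependently (LoopSL2 k) (Irred φ₁) (Irred φ₂) :=
    hv₁.actIndependently hv₂ (laurentAction_charPoly φ₁) (laurentAction_charPoly φ₂)
      (hcop.map Polynomial.toLaurent)
  have := hind.isIrreducible_tensorProduct hv₁.exists_eq_smul
  exact nonempty_irred_equiv (hv₁.tmul hv₂)

theorem mainTheorem5 {k : Type*} [Field k] [IsAlgClosed k] [CharZero k]
    (φ₁ φ₂ : ℤ → k) (h₁ : ExpPolyLoop.IsExpPoly φ₁) (h₂ : ExpPolyLoop.IsExpPoly φ₂)
    (hcop : IsCoprime (ExpPolyLoop.charPoly φ₁) (ExpPolyLoop.charPoly φ₂)) :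
    Nonempty (ExpPolyLoop.Irred (φ₁ + φ₂) ≃ₗ⁅k, ExpPolyLoop.LoopSL2 k⁆
      ExpPolyLoop.Irred φ₁ ⊗[k] ExpPolyLoop.Irred φ₂) :=
  mainTheorem5_general φ₁ φ₂ hcop
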